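/- Let $G$ be a finite undirected graph with $n$ vertices (multiple edges and loops are allowed, and $G$ need not be connected) and let $1 \le k \le n$. A matching of a graph $H$ is a set of non-loop edges of $H$, no two of which share a vertex. If $m_i(H)$ denotes the number of matchings of $H$ with $i$ edges, the matching polynomial of a finite graph $H$ with $N$ vertices is $$\mu_H(x) = \sum_{i=0}^{\lfloor N/2\rfloor} (-1)^i m_i(H)\, x^{N-2i}.$$ For a vertex $v$ of $G$ let $U_v(G)$ be the universal covering tree of (the component of $v$ in) $G$: its vertices are the non-backtracking walks in $G$ starting at $v$ (sequences of oriented edges, each starting where the previous one ends and none being the reverse of the previous one; a loop has two orientations), and two walks are adjacent if one extends the other by one step. The spectral radius $r(U)$ of a graph $U$ is the supremum, over the finite induced subgraphs $F$ of $U$, of the largest absolute value of an eigenvalue of the adjacency matrix of $F$. Put $\rho(G) = \max_{v} r(U_v(G))$; if $G$ is connected, all the trees $U_v(G)$ are isomorphic and $\rho(G)$ is the spectral radius of the universal covering tree of $G$. Then the uniform average $$\frac{1}{\binom{n}{k}} \sum_{\substack{S \subseteq V(G)\\ |S| = k}} \mu_{G[S]}(x)$$ of the matching polynomials of the subgraphs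 $G[S]$ of $G$ induced by $k$ vertices is real-rooted (all its complex zeros are real), and all its roots lie in the interval $[-\rho(G), \rho(G)]$. -/

import Mathlib

open Polynomial
open scoped Graph

namespace Graph

variable {α β : Type*}

/-! ### Matching polynomials of multigraphs -/

/-- A matching of a multigraph: a set of edges, none of which is a loop,
such that no two distinct edges of the set share a vertex. -/
def IsMatching (G : Graph α β) (M : Set β) : Prop :=
  M ⊆ E(G) ∧ (∀ e ∈ M, ∀ x, ¬ G.IsLoopAt e x) ∧
    ∀ e ∈ M, ∀ f ∈ M, ∀ x, G.Inc e x → G.Inc f x → e = f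

/-- The number `m_i` of matchings with exactly `i` edges. -/
noncomputable def matchingCount (G : Graph α β) (i : ℕ) : ℕ :=
  {M : Finset β | G.IsMatching (M : Set β) ∧ M.card = i}.ncard

/-- The matching polynomial `∑_{i ≤ n/2} (-1)^i m_i x^(n-2i)` of a finite multigraph,
where `n` is the number of vertices. -/
noncomputable def matchingPoly (G : Graph α β) : ℝ[X] :=
  ∑ i ∈ Finset.range (V(G).ncard / 2 + 1),
    C ((-1 : ℝ) ^ i * (G.matchingCount i : ℝ)) * X ^ (V(G).ncard - 2 * i)

/-- The uniform average of the matching polynomials of the induced subgraphs `G[S]`, where `S` runs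
over the `k`-element sets of vertices of `G`. -/
noncomputable def avgMatchingPoly (G : Graph α β) (hV : V(G).Finite) (k : ℕ) : ℝ[X] :=
  C (((V(G).ncard.choose k : ℕ) : ℝ)⁻¹) *
    ∑ S ∈ hV.toFinset.powersetCard k, (G.induce (S : Set α)).matchingPoly

/-! ### Oriented edges and the universal covering tree -/

/-- An oriented edge of a multigraph. Each edge has exactly two orientations. Those of a non-loop
are told apart by their tails; those of a loop are told apart by `sign`. -/
@[ext]
structure Dart (G : Graph α β) where
  edge : β
  tail : α
  head : α
  isLink : G.IsLink edge tail head
  sign : Bool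
  sign_eq : tail ≠ head → sign = false

open Classical in
/-- The same edge with the opposite orientation. -/
noncomputable def Dart.rev {G : Graph α β} (d : G.Dart) : G.Dart where
  edge := d.edge
  tail := d.head
  head := d.tail
  isLink := d.isLink.symm
  sign := if d.tail = d.head then !d.sign else false
  sign_eq h := if_neg h.symm

theorem Dart.rev_rev {G : Graph α β} (d : G.Dart) : d.rev.rev = d := by
  by_cases h : d.tail = d.head
  · ext <;> simp [Dart.rev, h]
  · have h' : ¬ d.head = d.tail := fun e => h e.symm
    ext <;> simp [Dart.rev, h', d.sign_eq h]

theorem Dart.rev_ne {G : Graph α β} (d : G.Dart) : d.rev ≠ d := by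
  intro e
  by_cases h : d.tail = d.head
  · have := congrArg Dart.sign e
    simp [Dart.rev, h] at this
  · exact h (congrArg Dart.head e)

/-- In a simple graph, a continuation `d'` of `d` is not the reverse of `d` exactly when it does not
return to the vertex from which `d` came. -/
theorem Dart.ne_rev_iff {G : Graph α β} [G.Simple] {d d' : G.Dart} (h : d.head = d'.tail) :
    d' ≠ d.rev ↔ d'.head ≠ d.tail := by
  have hne : ∀ c : G.Dart, c.tail ≠ c.head := fun c e => by
    have hc := c.isLink
    rw [e] at hc
    exact Graph.Loopless.not_isLoopAt c.edge c.head hc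
  refine not_congr ⟨fun e => by rw [e]; rfl, fun e => ?_⟩
  have h1 : G.IsLink d'.edge d.head d.tail := by
    have := d'.isLink
    rwa [← h, e] at this
  have h2 : d'.edge = d.edge := Graph.Simple.eq_of_isLink h1 d.isLink.symm
  ext <;> simp [Dart.rev, h2, h, e, d'.sign_eq (hne d')]
  rw [← h]; exact fun c => absurd c (hne d)

/-- The list of oriented edges is a non-backtracking walk starting at the vertex `i`: consecutive
oriented edges fit together, and none is followed by its own reverse. The empty list is the walk
of length `0` that consists of `i` alone. -/
def IsNonBacktracking (G : Graph α β) (i : α) (w : List G.Dart) : Prop :=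
  (∀ d ∈ w.head?, d.tail = i) ∧ w.IsChain (fun d d' => d.head = d'.tail ∧ d' ≠ d.rev)

/-- The universal covering tree of `G` with root `i` (of the connected component of `i`): its
vertices are the non-backtracking walks starting at `i`, and two walks are adjacent if one extends
the other by one step. -/
def universalCover (G : Graph α β) (i : α) :
    SimpleGraph {w : List G.Dart // G.IsNonBacktracking i w} where
  Adj u v := (∃ d, v.1 = u.1 ++ [d]) ∨ (∃ d, u.1 = v.1 ++ [d])
  symm := ⟨fun _ _ h => h.symm⟩
  loopless := ⟨fun u h => by simp at h⟩

end Graph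

/-! ### Spectral radius -/

open Classical in
/-- The spectral radius of a finite simple graph: the largest absolute value of an eigenvalue of its
adjacency matrix (which is real symmetric). It is `0` for the graph without vertices. -/
noncomputable def SimpleGraph.finSpectralRadius {W : Type*} [Fintype W] (H : SimpleGraph W) : ℝ :=
  sSup {r : ℝ | ∃ l : ℝ, Module.End.HasEigenvalue (Matrix.toLin' (H.adjMatrix ℝ)) l ∧ r = |l|}

/-- The spectral radius of a possibly infinite simple graph (of bounded degree): the supremum of the
spectral radii of its finite induced subgraphs. -/
noncomputable def SimpleGraph.supSpectralRadius {W : Type*} (U : SimpleGraph W) : ℝ :=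
  ⨆ s : Finset W, (U.induce (s : Set W)).finSpectralRadius

/-- The spectral radius of the universal covering tree of a finite multigraph. If `G` is connected,
the trees `G.universalCover i` are all isomorphic and the supremum is over equal numbers; in general
this is the spectral radius of the disjoint union of the universal covering trees of the connected
components of `G`. -/
noncomputable def Graph.rho {α β : Type*} (G : Graph α β) : ℝ :=
  ⨆ i : V(G), (G.universalCover (i : α)).supSpectralRadius

/-! Let `μ S` be the matching polynomial of `G[S]`. Splitting matchings at a vertex `v` gives `μ S =
x μ(S - v) - ∑ μ(S - v - h)`, over the oriented edges from `v` to `h ∈ S - v`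
(`matchingPoly_eq_sub`). Two consequences carry the theorem.

The first is Godsil's path tree. If `μ S` vanishes at `z` but `μ(S - v)` does not, put on each
self-avoiding walk in `S` from `v` the value at `z` of `μ` of the vertices not visited. The
recurrence says that this is an eigenvector, with eigenvalue `z`, of the tree of these walks.
Self-avoiding walks do not backtrack, so the tree is a finite induced subgraph of the universal
cover; its adjacency matrix is symmetric, hence `z` is real and `|z| ≤ ρ(G)`. If `μ(S - v)` vanishes
too, delete `v` and repeat (`im_eq_zero_and_abs_re_le_rho`).

The second is `(μ S)' = ∑ μ(S - v)` over `v ∈ S`. Hence the sum of `μ` over the `k`-subsets is, up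
to a nonzero constant, the derivative of the sum over the `(k+1)`-subsets. Starting from `μ` of the
full vertex set, Gauss–Lucas keeps all roots in the real segment `[-ρ(G), ρ(G)]`. -/

namespace Graph

/-! ### Matchings of induced subgraphs under deletion of vertices -/

section Matching

open scoped Classical

variable {α β : Type*} {G : Graph α β}

/-- Both ends of an edge of `M` lie in `S`, so incidence may be tested in `G`. The disjointness
condition then no longer mentions `S`, which lets matchings pass between vertex sets. -/
theorem isMatching_induce_iff {S : Set α} {M : Set β} :
    (G.induce S).IsMatching M ↔
      (∀ e ∈ M, ∃ x y, G.IsLink e x y ∧ x ≠ y ∧ x ∈ S ∧ y ∈ S) ∧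
        ∀ e ∈ M, ∀ f ∈ M, ∀ x, G.Inc e x → G.Inc f x → e = f := by
  have hinc : ∀ e x, (G.induce S).Inc e x ↔ ∃ y, G.IsLink e x y ∧ x ∈ S ∧ y ∈ S := fun e x => by
    simp [Graph.Inc]
  have hloop : ∀ e x, (G.induce S).IsLoopAt e x ↔ G.IsLink e x x ∧ x ∈ S := fun e x => by
    rw [← isLink_self_iff, induce_isLink]; simp
  simp only [IsMatching, hinc, hloop]
  constructor
  · rintro ⟨h1, h2, h3⟩
    have h4 : ∀ e ∈ M, ∃ x y, G.IsLink e x y ∧ x ≠ y ∧ x ∈ S ∧ y ∈ S := by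
      intro e he
      have := h1 he
      rw [edgeSet_induce] at this
      obtain ⟨x, y, hl, hx, hy⟩ := this
      refine ⟨x, y, hl, ?_, hx, hy⟩
      rintro rfl
      exact h2 e he x ⟨hl, hx⟩
    have h5 : ∀ e ∈ M, ∀ x, G.Inc e x → ∃ y, G.IsLink e x y ∧ x ∈ S ∧ y ∈ S := by
      intro e he x hx
      obtain ⟨a, b, hl, -, ha, hb⟩ := h4 e he
      rcases hx.eq_or_eq_of_isLink hl with rfl | rfl
      · exact ⟨b, hl, ha, hb⟩
      · exact ⟨a, hl.symm, hb, ha⟩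
    exact ⟨h4, fun e he f hf x hex hfx => h3 e he f hf x (h5 e he x hex) (h5 f hf x hfx)⟩
  · rintro ⟨h1, h2⟩
    refine ⟨fun e he => ?_, fun e he x hx => ?_, fun e he f hf x ⟨y, hy, _⟩ ⟨y', hy', _⟩ =>
      h2 e he f hf x hy.inc_left hy'.inc_left⟩
    · obtain ⟨x, y, hl, -, hx, hy⟩ := h1 e he
      rw [edgeSet_induce]
      exact ⟨x, y, hl, hx, hy⟩
    · obtain ⟨a, b, hl, hab, -, -⟩ := h1 e he
      rcases hl.left_eq_or_eq hx.1 with h | h <;> rcases hl.right_eq_or_eq hx.1 with h' | h' <;>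
        exact hab (h.trans h'.symm)

/-- The matchings with `i` edges of the subgraph induced by a vertex set. -/
def matchings (G : Graph α β) (S : Finset α) (i : ℕ) : Set (Finset β) :=
  {M | (G.induce (S : Set α)).IsMatching (M : Set β) ∧ M.card = i}

theorem matchings_finite (hE : E(G).Finite) (S : Finset α) (i : ℕ) :
    (G.matchings S i).Finite := by
  refine (hE.toFinset.powerset.finite_toSet).subset fun M hM => ?_
  simp only [Finset.coe_powerset, Set.mem_preimage, Set.mem_powerset_iff]
  intro e he
  obtain ⟨x, y, hl, -⟩ := (isMatching_induce_iff.1 hM.1).1 e he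
  simpa using hl.edge_mem

theorem matchings_zero (S : Finset α) : G.matchings S 0 = {∅} := by
  ext M
  simp only [matchings, Set.mem_ofPred_eq, Finset.card_eq_zero, Set.mem_singleton_iff,
    and_iff_right_iff_imp]
  rintro rfl
  simp [isMatching_induce_iff]

theorem matchings_empty_succ (i : ℕ) : G.matchings ∅ (i + 1) = ∅ := by
  ext M
  simp only [matchings, Set.mem_ofPred_eq, Set.mem_empty_iff_false, iff_false, not_and]
  intro h hc
  obtain ⟨e, he⟩ := Finset.card_pos.1 (by omega : 0 < M.card)
  obtain ⟨x, y, -, -, hx, -⟩ := (isMatching_induce_iff.1 h).1 e he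
  simp at hx

instance Dart.instFinite [Finite V(G)] [Finite E(G)] : Finite G.Dart := by
  let f : G.Dart → E(G) × V(G) × V(G) × Bool := fun d =>
    (⟨d.edge, d.isLink.edge_mem⟩, ⟨d.tail, d.isLink.left_mem⟩, ⟨d.head, d.isLink.right_mem⟩, d.sign)
  refine Finite.of_injective f fun c d h => ?_
  simp only [f, Prod.mk.injEq, Subtype.mk.injEq] at h
  exact Dart.ext h.1 h.2.1 h.2.2.1 h.2.2.2

theorem Dart.eq_of_edge_eq {c d : G.Dart} (he : c.edge = d.edge) (ht : c.tail = d.tail)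
    (hc : c.tail ≠ c.head) : c = d := by
  have hh : c.head = d.head := by
    have h := c.isLink
    rw [he, ht] at h
    exact h.right_unique d.isLink
  exact Dart.ext he ht hh (by rw [c.sign_eq hc, d.sign_eq (by rwa [← ht, ← hh])])

theorem mem_of_mem_matchings {S : Finset α} {M : Finset β} {i : ℕ} (hM : M ∈ G.matchings S i)
    {e : β} (he : e ∈ M) {x : α} (hx : G.Inc e x) : x ∈ S := by
  obtain ⟨a, b, hl, -, ha, hb⟩ := (isMatching_induce_iff.1 hM.1).1 e he
  rcases hx.eq_or_eq_of_isLink hl with rfl | rfl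
  · exact ha
  · exact hb

theorem insert_mem_matchings {S : Finset α} {v h : α} {e : β} {M : Finset β} {i : ℕ}
    (he : G.IsLink e v h) (hv : v ∈ S) (hh : h ∈ S.erase v)
    (hM : M ∈ G.matchings ((S.erase v).erase h) i) :
    insert e M ∈ G.matchings S (i + 1) := by
  have hM' := isMatching_induce_iff.1 hM.1
  have hne : ∀ f ∈ M, ∀ x, G.Inc e x → G.Inc f x → False := by
    intro f hf x hex hfx
    have := mem_of_mem_matchings hM hf hfx
    rcases hex.eq_or_eq_of_isLink he with rfl | rfl <;> simp at this
  have heM : e ∉ M := fun h' => hne e h' v he.inc_left he.inc_left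
  refine ⟨isMatching_induce_iff.2 ⟨?_, ?_⟩, by rw [Finset.card_insert_of_notMem heM, hM.2]⟩
  · intro f hf
    rw [Finset.coe_insert, Set.mem_insert_iff] at hf
    rcases hf with rfl | hf
    · exact ⟨v, h, he, (Finset.ne_of_mem_erase hh).symm, hv, Finset.mem_of_mem_erase hh⟩
    · obtain ⟨x, y, hl, hxy, hx, hy⟩ := hM'.1 f hf
      exact ⟨x, y, hl, hxy, Finset.mem_of_mem_erase (Finset.mem_of_mem_erase hx),
        Finset.mem_of_mem_erase (Finset.mem_of_mem_erase hy)⟩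
  · intro f hf g hg x hfx hgx
    rw [Finset.coe_insert, Set.mem_insert_iff] at hf hg
    rcases hf with rfl | hf <;> rcases hg with rfl | hg
    · rfl
    · exact (hne g hg x hfx hgx).elim
    · exact (hne f hf x hgx hfx).elim
    · exact hM'.2 f hf g hg x hfx hgx

theorem erase_mem_matchings {S : Finset α} {v h : α} {e : β} {M : Finset β} {i : ℕ}
    (he : G.IsLink e v h) (heM : e ∈ M) (hM : M ∈ G.matchings S (i + 1)) :
    M.erase e ∈ G.matchings ((S.erase v).erase h) i := by
  have hM' := isMatching_induce_iff.1 hM.1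
  refine ⟨isMatching_induce_iff.2 ⟨?_, fun f hf g hg => hM'.2 f (Finset.mem_of_mem_erase hf) g
    (Finset.mem_of_mem_erase hg)⟩, by rw [Finset.card_erase_of_mem heM, hM.2]; rfl⟩
  intro f hf
  have hfM := Finset.mem_of_mem_erase hf
  obtain ⟨x, y, hl, hxy, hx, hy⟩ := hM'.1 f hfM
  have key : ∀ z, G.Inc f z → z ≠ v ∧ z ≠ h := fun z hz =>
    ⟨fun c => Finset.ne_of_mem_erase hf (hM'.2 f hfM e heM z hz (c ▸ he.inc_left)),
      fun c => Finset.ne_of_mem_erase hf (hM'.2 f hfM e heM z hz (c ▸ he.inc_right))⟩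
  refine ⟨x, y, hl, hxy, ?_, ?_⟩
  · simpa [key x hl.inc_left] using hx
  · simpa [key y hl.inc_right] using hy

theorem mem_matchings_erase_iff {S : Finset α} {v : α} {M : Finset β} {i : ℕ} :
    M ∈ G.matchings (S.erase v) i ↔ M ∈ G.matchings S i ∧ ∀ e ∈ M, ¬ G.Inc e v := by
  constructor
  · intro hM
    refine ⟨⟨isMatching_induce_iff.2 ⟨fun e he => ?_, (isMatching_induce_iff.1 hM.1).2⟩, hM.2⟩,
      fun e he hv => by simpa using mem_of_mem_matchings hM he hv⟩
    obtain ⟨x, y, hl, hxy, hx, hy⟩ := (isMatching_induce_iff.1 hM.1).1 e he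
    exact ⟨x, y, hl, hxy, Finset.mem_of_mem_erase hx, Finset.mem_of_mem_erase hy⟩
  · rintro ⟨hM, h⟩
    refine ⟨isMatching_induce_iff.2 ⟨fun e he => ?_, (isMatching_induce_iff.1 hM.1).2⟩, hM.2⟩
    obtain ⟨x, y, hl, hxy, hx, hy⟩ := (isMatching_induce_iff.1 hM.1).1 e he
    exact ⟨x, y, hl, hxy, Finset.mem_erase.2 ⟨fun c => h e he (c ▸ hl.inc_left), hx⟩,
      Finset.mem_erase.2 ⟨fun c => h e he (c ▸ hl.inc_right), hy⟩⟩

/-! ### The vertex recurrence and the derivative of the matching polynomial -/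

variable [Fintype G.Dart]

/-- The oriented edges from `v` to a vertex of `S`. -/
noncomputable def dartsTo (G : Graph α β) [Fintype G.Dart] (v : α) (S : Finset α) : Finset G.Dart :=
  Finset.univ.filter fun d => d.tail = v ∧ d.head ∈ S

theorem mem_dartsTo {v : α} {S : Finset α} {d : G.Dart} :
    d ∈ G.dartsTo v S ↔ d.tail = v ∧ d.head ∈ S := by
  simp [dartsTo]

theorem Dart.tail_ne_head_of_mem_dartsTo {v : α} {S : Finset α} {d : G.Dart}
    (hd : d ∈ G.dartsTo v (S.erase v)) : d.tail ≠ d.head := by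
  rw [mem_dartsTo] at hd
  rw [hd.1]
  exact (Finset.ne_of_mem_erase hd.2).symm

/-- Either a matching misses `v`, or exactly one of its edges covers `v`; removing that edge leaves
a matching that avoids both its ends. Summing over oriented edges rather than neighbours counts
parallel edges separately. -/
theorem matchingCount_succ (hE : E(G).Finite) {S : Finset α} {v : α} (hv : v ∈ S) (i : ℕ) :
    (G.induce (S : Set α)).matchingCount (i + 1) =
      (G.induce (S.erase v : Set α)).matchingCount (i + 1) +
        ∑ d ∈ G.dartsTo v (S.erase v),
          (G.induce ((S.erase v).erase d.head : Set α)).matchingCount i := by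
  have hm : ∀ (T : Finset α) (j : ℕ), (G.induce (T : Set α)).matchingCount j =
      (matchings_finite hE T j).toFinset.card := fun T j =>
    Set.ncard_eq_toFinset_card (G.matchings T j) (matchings_finite hE T j)
  have hnotMem : ∀ d ∈ G.dartsTo v (S.erase v), ∀ j, ∀ M ∈
      G.matchings ((S.erase v).erase d.head) j, d.edge ∉ M := by
    intro d hd j M hM h
    have := mem_of_mem_matchings hM h d.isLink.inc_right
    simp at this
  have hset : (matchings_finite hE S (i + 1)).toFinset =
      (matchings_finite hE (S.erase v) (i + 1)).toFinset ∪
        (G.dartsTo v (S.erase v)).biUnion fun d =>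
          (matchings_finite hE ((S.erase v).erase d.head) i).toFinset.image (insert d.edge) := by
    ext M
    simp only [Set.Finite.mem_toFinset, Finset.mem_union, Finset.mem_biUnion, Finset.mem_image]
    constructor
    · intro hM
      by_cases h : ∀ e ∈ M, ¬ G.Inc e v
      · exact Or.inl (mem_matchings_erase_iff.2 ⟨hM, h⟩)
      · push Not at h
        obtain ⟨e, he, hev⟩ := h
        obtain ⟨w, hw⟩ := hev
        have hwS := mem_of_mem_matchings hM he hw.inc_right
        have hwv : w ≠ v := by
          rintro rfl
          obtain ⟨x, y, hl, hxy, -⟩ := (isMatching_induce_iff.1 hM.1).1 e he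
          rcases hl.left_eq_or_eq hw with h | h <;> rcases hl.right_eq_or_eq hw with h' | h' <;>
            exact hxy (h.trans h'.symm)
        refine Or.inr ⟨⟨e, v, w, hw, false, fun _ => rfl⟩,
          mem_dartsTo.2 ⟨rfl, Finset.mem_erase.2 ⟨hwv, hwS⟩⟩, M.erase e,
          erase_mem_matchings hw he hM, Finset.insert_erase he⟩
    · rintro (hM | ⟨d, hd, M, hM, rfl⟩)
      · exact (mem_matchings_erase_iff.1 hM).1
      · rw [mem_dartsTo] at hd
        exact insert_mem_matchings (hd.1 ▸ d.isLink) hv hd.2 hM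
  rw [hm, hset, Finset.card_union_of_disjoint, Finset.card_biUnion, ← hm]
  · congr 1
    refine Finset.sum_congr rfl fun d hd => ?_
    rw [Finset.card_image_of_injOn, ← hm]
    · intro M hM N hN h
      rw [Finset.mem_coe, Set.Finite.mem_toFinset] at hM hN
      have h' := congrArg (Finset.erase · d.edge) h
      simpa [Finset.erase_insert (hnotMem d hd i M hM),
        Finset.erase_insert (hnotMem d hd i N hN)] using h'
  · intro c hc d hd hcd
    refine Finset.disjoint_left.2 fun M hMc hMd => hcd ?_
    simp only [Finset.mem_image, Set.Finite.mem_toFinset] at hMc hMd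
    obtain ⟨N, hN, rfl⟩ := hMc
    obtain ⟨N', hN', h⟩ := hMd
    have hct := (mem_dartsTo.1 hc).1
    have hdt := (mem_dartsTo.1 hd).1
    refine Dart.eq_of_edge_eq ?_ (hct.trans hdt.symm) (Dart.tail_ne_head_of_mem_dartsTo hc)
    have hmem : c.edge ∈ insert d.edge N' := h ▸ Finset.mem_insert_self _ _
    rcases Finset.mem_insert.1 hmem with h | h
    · exact h
    · have := mem_of_mem_matchings hN' h c.isLink.inc_left
      simp [hct] at this
  · refine Finset.disjoint_left.2 fun M hM hM' => ?_
    simp only [Finset.mem_biUnion, Finset.mem_image, Set.Finite.mem_toFinset] at hM hM'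
    obtain ⟨d, hd, N, hN, rfl⟩ := hM'
    have := (mem_matchings_erase_iff.1 hM).2 d.edge (Finset.mem_insert_self _ _)
    exact this ((mem_dartsTo.1 hd).1 ▸ d.isLink.inc_left)

omit [Fintype G.Dart] in
theorem matchingCount_induce_zero (S : Finset α) :
    (G.induce (S : Set α)).matchingCount 0 = 1 := by
  change (G.matchings S 0).ncard = 1
  rw [matchings_zero, Set.ncard_singleton]

theorem matchingCount_eq_zero (hE : E(G).Finite) : ∀ (n : ℕ) (S : Finset α) (i : ℕ),
    S.card = n → n < 2 * i → (G.induce (S : Set α)).matchingCount i = 0 := by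
  intro n
  induction n using Nat.strong_induction_on with
  | _ n ih =>
    intro S i hS hi
    obtain ⟨i, rfl⟩ : ∃ j, i = j + 1 := ⟨i - 1, by omega⟩
    rcases S.eq_empty_or_nonempty with rfl | ⟨v, hv⟩
    · change (G.matchings ∅ (i + 1)).ncard = 0
      rw [matchings_empty_succ, Set.ncard_empty]
    · have hc := Finset.card_erase_add_one hv
      rw [matchingCount_succ hE hv, ih (n - 1) (by omega) _ _ (by omega) (by omega), zero_add]
      refine Finset.sum_eq_zero fun d hd => ?_
      have hc' := Finset.card_erase_add_one (mem_dartsTo.1 hd).2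
      exact ih (n - 2) (by omega) _ _ (by omega) (by omega)

/-- The extra terms have zero coefficients. A free upper limit allows polynomials of different
vertex sets to be compared termwise. -/
theorem matchingPoly_induce (hE : E(G).Finite) (S : Finset α) (N : ℕ) (hN : S.card < 2 * N) :
    (G.induce (S : Set α)).matchingPoly = ∑ i ∈ Finset.range N,
      C ((-1 : ℝ) ^ i * ((G.induce (S : Set α)).matchingCount i : ℝ)) * X ^ (S.card - 2 * i) := by
  have hV : V(G.induce (S : Set α)).ncard = S.card := by
    rw [show V(G.induce (S : Set α)) = (S : Set α) from rfl, Set.ncard_coe_finset]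
  rw [matchingPoly, hV]
  refine Finset.sum_subset (Finset.range_subset_range.2 (by omega)) fun i _ hi => ?_
  rw [Finset.mem_range] at hi
  rw [matchingCount_eq_zero hE _ S i rfl (by omega)]
  simp

theorem matchingPoly_induce_empty (hE : E(G).Finite) :
    (G.induce ((∅ : Finset α) : Set α)).matchingPoly = 1 := by
  rw [matchingPoly_induce hE ∅ 1 (by simp), Finset.sum_range_one, matchingCount_induce_zero]
  simp

theorem matchingPoly_eq_sub (hE : E(G).Finite) {S : Finset α} {v : α} (hv : v ∈ S) :
    (G.induce (S : Set α)).matchingPoly =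
      X * (G.induce (S.erase v : Set α)).matchingPoly -
        ∑ d ∈ G.dartsTo v (S.erase v),
          (G.induce ((S.erase v).erase d.head : Set α)).matchingPoly := by
  have hc := Finset.card_erase_add_one hv
  have h2 : ∀ d ∈ G.dartsTo v (S.erase v), ((S.erase v).erase d.head).card + 2 = S.card := by
    intro d hd
    have := Finset.card_erase_add_one (mem_dartsTo.1 hd).2
    omega
  -- One term fewer than for `S`: the covering edge shifts the index from `i + 1` to `i`, and the
  -- term `i = 0` of `S` is treated apart.
  have h3 := Finset.sum_congr (rfl : G.dartsTo v (S.erase v) = _) fun d hd =>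
    matchingPoly_induce hE ((S.erase v).erase d.head) S.card (by have := h2 d hd; omega)
  rw [matchingPoly_induce hE S (S.card + 1) (by omega),
    matchingPoly_induce hE (S.erase v) (S.card + 1) (by omega), h3,
    Finset.sum_comm, Finset.sum_range_succ', Finset.sum_range_succ', mul_add, Finset.mul_sum,
    add_sub_right_comm, ← Finset.sum_sub_distrib]
  congr 1
  · refine Finset.sum_congr rfl fun i _ => ?_
    have hX : ∀ d ∈ G.dartsTo v (S.erase v),
        C ((-1 : ℝ) ^ i * ((G.induce ((S.erase v).erase d.head : Set α)).matchingCount i : ℝ)) *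
          X ^ (((S.erase v).erase d.head).card - 2 * i) =
        C ((-1 : ℝ) ^ i * ((G.induce ((S.erase v).erase d.head : Set α)).matchingCount i : ℝ)) *
          X ^ (S.card - 2 * (i + 1)) := fun d hd => by
      rw [show ((S.erase v).erase d.head).card - 2 * i = S.card - 2 * (i + 1) by
        have := h2 d hd; omega]
    have hX' : X * (C ((-1 : ℝ) ^ (i + 1) *
          ((G.induce (S.erase v : Set α)).matchingCount (i + 1) : ℝ)) *
          X ^ ((S.erase v).card - 2 * (i + 1))) =
        C ((-1 : ℝ) ^ (i + 1) * ((G.induce (S.erase v : Set α)).matchingCount (i + 1) : ℝ)) *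
          X ^ (S.card - 2 * (i + 1)) := by
      -- Here truncated subtraction may break the identity of exponents, but the coefficient
      -- vanishes.
      by_cases h : (S.erase v).card < 2 * (i + 1)
      · rw [matchingCount_eq_zero hE _ _ _ rfl h]
        simp
      · rw [show S.card - 2 * (i + 1) = (S.erase v).card - 2 * (i + 1) + 1 by omega, pow_succ]
        ring
    rw [Finset.sum_congr rfl hX, hX', matchingCount_succ hE hv, ← Finset.sum_mul, ← sub_mul]
    congr 1
    rw [← map_sum, ← map_sub, ← Finset.mul_sum]
    push_cast
    congr 1
    ring
  · rw [matchingCount_induce_zero, matchingCount_induce_zero, ← hc]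
    simp only [pow_zero, mul_zero, Nat.sub_zero, Nat.cast_one, mul_one, map_one, one_mul, pow_succ]
    ring

/-- Differentiate the recurrence at a fixed `v`. The product rule yields `μ(S - v)`; by induction
the other terms are the recurrences at `v` of `μ(S - u)`, summed over `u ≠ v`. Only the recurrence
and `μ ∅ = 1` are used. -/
theorem derivative_matchingPoly (hE : E(G).Finite) (S : Finset α) :
    derivative (G.induce (S : Set α)).matchingPoly =
      ∑ v ∈ S, (G.induce (S.erase v : Set α)).matchingPoly := by
  have hrec := fun (T : Finset α) v (hv : v ∈ T) => matchingPoly_eq_sub hE hv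
  have hempty := matchingPoly_induce_empty hE
  obtain ⟨μ, hμ⟩ : ∃ μ : Finset α → ℝ[X], ∀ T : Finset α, (G.induce (T : Set α)).matchingPoly = μ T :=
    ⟨_, fun _ => rfl⟩
  simp only [hμ] at hrec hempty ⊢
  induction h : S.card using Nat.strong_induction_on generalizing S with
  | _ n ih =>
    rcases S.eq_empty_or_nonempty with rfl | ⟨v, hv⟩
    · rw [hempty]
      simp
    have hc := Finset.card_erase_add_one hv
    have hdarts : ∀ u ∈ S.erase v, G.dartsTo v ((S.erase u).erase v) =
        (G.dartsTo v (S.erase v)).filter fun d => u ∈ (S.erase v).erase d.head := by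
      intro u hu
      ext d
      simp only [mem_dartsTo, Finset.mem_filter, Finset.mem_erase] at hu ⊢
      grind
    have hu : ∑ u ∈ S.erase v, μ (S.erase u) = ∑ u ∈ S.erase v, (X * μ ((S.erase v).erase u) -
        ∑ d ∈ G.dartsTo v (S.erase v), if u ∈ (S.erase v).erase d.head then
          μ (((S.erase v).erase d.head).erase u) else 0) := by
      refine Finset.sum_congr rfl fun u hu => ?_
      rw [hrec _ v (Finset.mem_erase.2 ⟨(Finset.ne_of_mem_erase hu).symm, hv⟩), hdarts u hu,
        Finset.sum_filter, Finset.erase_right_comm (a := u) (b := v)]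
      congr 1
      refine Finset.sum_congr rfl fun d _ => ?_
      rw [Finset.erase_right_comm (a := u)]
    have hd : ∑ d ∈ G.dartsTo v (S.erase v), derivative (μ ((S.erase v).erase d.head)) =
        ∑ d ∈ G.dartsTo v (S.erase v), ∑ u ∈ S.erase v, if u ∈ (S.erase v).erase d.head then
          μ (((S.erase v).erase d.head).erase u) else 0 := by
      refine Finset.sum_congr rfl fun d hd => ?_
      have := Finset.card_erase_add_one (mem_dartsTo.1 hd).2
      rw [ih _ (by omega) ((S.erase v).erase d.head) rfl, ← Finset.sum_filter]
      refine Finset.sum_congr ?_ fun u _ => rfl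
      ext u
      simp only [Finset.mem_filter, Finset.mem_erase]
      tauto
    rw [← Finset.add_sum_erase S _ hv, hu, hrec S v hv, derivative_sub, derivative_mul,
      derivative_X, one_mul, derivative_sum, ih _ (by omega) (S.erase v) rfl,
      Finset.sum_sub_distrib, ← Finset.mul_sum, hd, Finset.sum_comm (s := S.erase v), add_sub_assoc]

end Matching
end Graph

/-! ### Eigenvalues of adjacency matrices and the spectral radius -/

namespace SimpleGraph

open scoped Classical

variable {W : Type*}

/-- Gershgorin's theorem: the diagonal is zero and a row sums to the degree. -/
theorem abs_le_of_hasEigenvalue_adjMatrix [Fintype W] {H : SimpleGraph W} {D : ℕ}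
    (hD : ∀ w, (Finset.univ.filter (H.Adj w)).card ≤ D) {l : ℝ}
    (hl : Module.End.HasEigenvalue (Matrix.toLin' (H.adjMatrix ℝ)) l) : |l| ≤ D := by
  obtain ⟨w, hw⟩ := eigenvalue_mem_ball hl
  rw [Metric.mem_closedBall, adjMatrix_apply, if_neg (H.irrefl), dist_zero_right,
    Real.norm_eq_abs] at hw
  refine hw.trans (le_trans ?_ (Nat.cast_le.2 (hD w)))
  rw [Finset.card_filter]
  push_cast
  refine (Finset.sum_le_sum_of_subset_of_nonneg (Finset.erase_subset _ _)
    fun _ _ _ => norm_nonneg _).trans (Finset.sum_le_sum fun u _ => ?_)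
  rw [adjMatrix_apply]
  split_ifs <;> simp

theorem abs_le_finSpectralRadius [Fintype W] (H : SimpleGraph W) {l : ℝ}
    (hl : Module.End.HasEigenvalue (Matrix.toLin' (H.adjMatrix ℝ)) l) :
    |l| ≤ H.finSpectralRadius := by
  refine le_csSup ⟨(Fintype.card W : ℕ), ?_⟩ ⟨l, hl, rfl⟩
  rintro r ⟨l', hl', rfl⟩
  exact abs_le_of_hasEigenvalue_adjMatrix (fun w => Finset.card_le_univ _) hl'

theorem finSpectralRadius_le [Fintype W] {H : SimpleGraph W} {D : ℕ}
    (hD : ∀ w, (Finset.univ.filter (H.Adj w)).card ≤ D) : H.finSpectralRadius ≤ D := by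
  refine Real.sSup_le ?_ (Nat.cast_nonneg _)
  rintro r ⟨l, hl, rfl⟩
  exact abs_le_of_hasEigenvalue_adjMatrix hD hl

/-- The degree bound keeps the family bounded above; a real supremum of an unbounded family would
take the default value `0`. -/
theorem finSpectralRadius_induce_le_supSpectralRadius {U : SimpleGraph W} {D : ℕ}
    (hD : ∀ w (t : Finset W), (∀ u ∈ t, U.Adj w u) → t.card ≤ D) (s : Finset W) :
    (U.induce (s : Set W)).finSpectralRadius ≤ U.supSpectralRadius := by
  refine le_ciSup (f := fun s : Finset W => (U.induce (s : Set W)).finSpectralRadius)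
    ⟨(D : ℝ), ?_⟩ s
  rintro _ ⟨t, rfl⟩
  refine finSpectralRadius_le fun w => ?_
  rw [← Finset.card_map (Function.Embedding.subtype _)]
  refine hD w _ fun u hu => ?_
  obtain ⟨u', hu', rfl⟩ := Finset.mem_map.1 hu
  exact (Finset.mem_filter.1 hu').2

/-- A complex eigenvalue of the adjacency matrix is real and bounded by the spectral radius. -/
theorem im_eq_zero_and_abs_re_le_finSpectralRadius [Fintype W] (H : SimpleGraph W) {z : ℂ}
    {φ : W → ℂ} (hφ : φ ≠ 0)
    (h : ∀ w, ∑ u ∈ Finset.univ.filter (H.Adj w), φ u = z * φ w) :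
    z.im = 0 ∧ |z.re| ≤ H.finSpectralRadius := by
  have hsq : ∑ w, starRingEnd ℂ (φ w) * φ w ≠ 0 := by
    have h1 : ∑ w, starRingEnd ℂ (φ w) * φ w = ((∑ w, Complex.normSq (φ w) : ℝ) : ℂ) := by
      push_cast
      exact Finset.sum_congr rfl fun w _ => (Complex.normSq_eq_conj_mul_self).symm
    rw [h1, Ne, Complex.ofReal_eq_zero,
      Finset.sum_eq_zero_iff_of_nonneg fun _ _ => Complex.normSq_nonneg _]
    intro h2
    exact hφ (funext fun w => Complex.normSq_eq_zero.1 (h2 w (Finset.mem_univ w)))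
  -- The sum of `conj (φ w) * φ u` over adjacent pairs is symmetric in `w` and `u`, and equals both
  -- `z` and `conj z` times the squared norm of `φ`.
  have hz : starRingEnd ℂ z = z := by
    refine mul_right_cancel₀ hsq ?_
    have h1 : z * ∑ w, starRingEnd ℂ (φ w) * φ w =
        ∑ w, ∑ u, if H.Adj w u then starRingEnd ℂ (φ w) * φ u else 0 := by
      rw [Finset.mul_sum]
      refine Finset.sum_congr rfl fun w _ => ?_
      rw [← Finset.sum_filter, ← Finset.mul_sum, h]
      ring
    have h2 : starRingEnd ℂ z * ∑ w, starRingEnd ℂ (φ w) * φ w =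
        ∑ w, ∑ u, if H.Adj w u then starRingEnd ℂ (φ u) * φ w else 0 := by
      rw [Finset.mul_sum]
      refine Finset.sum_congr rfl fun w _ => ?_
      rw [← Finset.sum_filter, ← Finset.sum_mul, ← map_sum, h, map_mul, mul_assoc]
    rw [h1, h2, Finset.sum_comm]
    simp only [H.adj_comm]
  have him : z.im = 0 := Complex.conj_eq_iff_im.1 hz
  refine ⟨him, ?_⟩
  have key : ∀ ψ : W → ℝ, ψ ≠ 0 →
      (∀ w, ∑ u ∈ Finset.univ.filter (H.Adj w), ψ u = z.re * ψ w) →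
      |z.re| ≤ H.finSpectralRadius := by
    intro ψ hψ h'
    refine H.abs_le_finSpectralRadius (Module.End.hasEigenvalue_of_hasEigenvector
      (x := ψ) ⟨Module.End.mem_eigenspace_iff.2 (funext fun w => ?_), hψ⟩)
    rw [Matrix.toLin'_apply, Matrix.mulVec, dotProduct, Pi.smul_apply, smul_eq_mul, ← h' w,
      Finset.sum_filter]
    refine Finset.sum_congr rfl fun u _ => ?_
    rw [adjMatrix_apply]
    split_ifs <;> simp
  -- As `z` is real, the real and imaginary parts of `φ` both satisfy the eigenvalue equation, and
  -- one of them is nonzero.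
  by_cases hre : (fun w => (φ w).re) = 0
  · refine key (fun w => (φ w).im) (fun hi => hφ (funext fun w => ?_)) fun w => ?_
    · exact Complex.ext (congrFun hre w) (congrFun hi w)
    · have := congrArg Complex.im (h w)
      simpa [him] using this
  · refine key _ hre fun w => ?_
    have := congrArg Complex.re (h w)
    simpa [him] using this

end SimpleGraph

namespace Graph

/-! ### Finite subgraphs of the universal cover -/

section CoverRadius

open scoped Classical

variable {α β : Type*} {G : Graph α β}

theorem card_le_of_forall_universalCover_adj [Fintype G.Dart] {v : α}
    (w : {w : List G.Dart // G.IsNonBacktracking v w})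
    (t : Finset {w : List G.Dart // G.IsNonBacktracking v w})
    (ht : ∀ u ∈ t, (G.universalCover v).Adj w u) : t.card ≤ Fintype.card (Option G.Dart) := by
  -- A longer neighbour of `w` is determined by its last oriented edge; the only possible shorter
  -- one is sent to `none`.
  let f : {w : List G.Dart // G.IsNonBacktracking v w} → Option G.Dart := fun u =>
    if w.1.length < u.1.length then u.1.getLast? else none
  refine Finset.card_le_card_of_injOn f (fun _ _ => Finset.mem_univ _) ?_
  intro a ha b hb hab
  rcases ht a ha with ⟨c, hc⟩ | ⟨c, hc⟩ <;> rcases ht b hb with ⟨d, hd⟩ | ⟨d, hd⟩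
  · refine Subtype.ext ?_
    have : c = d := by simpa [f, hc, hd] using hab
    rw [hc, hd, this]
  · simp [f, hc, hd] at hab
  · simp [f, hc, hd] at hab
  · refine Subtype.ext ?_
    rw [hc] at hd
    exact (List.append_inj' hd rfl).1

theorem finSpectralRadius_induce_universalCover_le_rho [Finite V(G)] [Fintype G.Dart] {v : α}
    (hv : v ∈ V(G)) (s : Finset {w : List G.Dart // G.IsNonBacktracking v w}) :
    ((G.universalCover v).induce
      (s : Set {w : List G.Dart // G.IsNonBacktracking v w})).finSpectralRadius ≤ G.rho :=
  (SimpleGraph.finSpectralRadius_induce_le_supSpectralRadius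
    card_le_of_forall_universalCover_adj s).trans
    (le_ciSup (f := fun i : V(G) => (G.universalCover (i : α)).supSpectralRadius)
      (Set.finite_range _).bddAbove ⟨v, hv⟩)

end CoverRadius

/-! ### The tree of self-avoiding walks -/

section PathTree

open scoped Classical

variable {α β : Type*} {G : Graph α β}

/-- The last vertex of a walk starting at `v`. -/
def walkEnd (v : α) (w : List G.Dart) : α := (w.map Dart.head).getLast?.getD v

/-- The vertices visited by a walk starting at `v`. -/
noncomputable def walkSupport (v : α) (w : List G.Dart) : Finset α :=
  insert v (w.map Dart.head).toFinset

theorem walkEnd_nil (v : α) : walkEnd v ([] : List G.Dart) = v := rfl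

theorem walkEnd_concat (v : α) (w : List G.Dart) (d : G.Dart) :
    walkEnd v (w ++ [d]) = d.head := by
  simp [walkEnd]

theorem walkSupport_nil (v : α) : walkSupport v ([] : List G.Dart) = {v} := by
  simp [walkSupport]

theorem walkSupport_concat (v : α) (w : List G.Dart) (d : G.Dart) :
    walkSupport v (w ++ [d]) = insert d.head (walkSupport v w) := by
  ext x
  simp [walkSupport]
  tauto

theorem walkEnd_mem_walkSupport (v : α) (w : List G.Dart) : walkEnd v w ∈ walkSupport v w := by
  rcases w.eq_nil_or_concat' with rfl | ⟨w, d, rfl⟩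
  · simp [walkEnd_nil, walkSupport_nil]
  · simp [walkEnd_concat, walkSupport_concat]

/-- The self-avoiding walks inside `S` starting at `v`. -/
inductive IsSelfAvoiding (S : Finset α) (v : α) : List G.Dart → Prop
  | nil : IsSelfAvoiding S v []
  | concat {w : List G.Dart} {d : G.Dart} (hw : IsSelfAvoiding S v w)
      (ht : d.tail = walkEnd v w) (hh : d.head ∈ S \ walkSupport v w) :
      IsSelfAvoiding S v (w ++ [d])

theorem isSelfAvoiding_concat_iff {S : Finset α} {v : α} {w : List G.Dart} {d : G.Dart} :
    IsSelfAvoiding S v (w ++ [d]) ↔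
      IsSelfAvoiding S v w ∧ d.tail = walkEnd v w ∧ d.head ∈ S \ walkSupport v w := by
  refine ⟨fun h => ?_, fun h => .concat h.1 h.2.1 h.2.2⟩
  generalize hl : w ++ [d] = l at h
  cases h with
  | nil => simp at hl
  | concat hw ht hh =>
    obtain ⟨rfl, h2⟩ := List.append_inj' hl rfl
    obtain rfl : d = _ := by simpa using h2
    exact ⟨hw, ht, hh⟩

namespace IsSelfAvoiding

variable {S : Finset α} {v : α} {w : List G.Dart}

theorem tail_mem_walkSupport (h : IsSelfAvoiding S v w) : ∀ d ∈ w, d.tail ∈ walkSupport v w := by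
  induction h with
  | nil => simp
  | @concat w d hw ht hh ih =>
    intro c hc
    rw [walkSupport_concat]
    refine Finset.mem_insert_of_mem ?_
    rcases List.mem_append.1 hc with hc | hc
    · exact ih c hc
    · rw [List.mem_singleton.1 hc, ht]
      exact walkEnd_mem_walkSupport v w

/-- Reversing the last step would lead back to its tail, which has been visited. -/
theorem isNonBacktracking (h : IsSelfAvoiding S v w) : G.IsNonBacktracking v w := by
  induction h with
  | nil => simp [IsNonBacktracking]
  | @concat w d hw ht hh ih =>
    rcases w.eq_nil_or_concat' with rfl | ⟨w, c, rfl⟩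
    · simpa [IsNonBacktracking, walkEnd_nil] using ht
    · refine ⟨fun a ha => ih.1 a ?_, ?_⟩
      · rwa [List.head?_append_of_ne_nil _ (by simp)] at ha
      · rw [List.isChain_append]
        refine ⟨ih.2, by simp, fun a ha b hb => ?_⟩
        obtain rfl : c = a := by simpa using ha
        obtain rfl : d = b := by simpa using hb
        rw [walkEnd_concat] at ht
        refine ⟨ht.symm, ?_⟩
        rintro rfl
        exact (Finset.mem_sdiff.1 hh).2 (hw.tail_mem_walkSupport c (by simp))

theorem card_walkSupport (h : IsSelfAvoiding S v w) (hv : v ∈ S) :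
    walkSupport v w ⊆ S ∧ (walkSupport v w).card = w.length + 1 := by
  induction h with
  | nil => simp [walkSupport_nil, hv]
  | concat hw ht hh ih =>
    rw [Finset.mem_sdiff] at hh
    rw [walkSupport_concat, Finset.card_insert_of_notMem hh.2, ih.2, List.length_append]
    exact ⟨Finset.insert_subset hh.1 ih.1, rfl⟩

end IsSelfAvoiding

theorem finite_isSelfAvoiding [Finite G.Dart] {S : Finset α} {v : α} (hv : v ∈ S) :
    {w : {w : List G.Dart // G.IsNonBacktracking v w} | IsSelfAvoiding S v w.1}.Finite := by
  refine Set.Finite.of_finite_image ((List.finite_length_le G.Dart S.card).subset ?_)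
    Subtype.val_injective.injOn
  rintro _ ⟨w, hw, rfl⟩
  have h := hw.card_walkSupport hv
  have := Finset.card_le_card h.1
  simp only [Set.mem_ofPred_eq]
  omega

/-- The values of the matching polynomials of the vertex sets left by the self-avoiding walks from
`v` form an eigenvector of the adjacency matrix of the tree of these walks. -/
theorem im_eq_zero_and_abs_re_le_rho_of_aeval_erase_ne_zero [Finite V(G)] [Finite E(G)]
    {S : Finset α} {v : α} (hvS : v ∈ S) (hvG : v ∈ V(G)) {z : ℂ}
    (hz : aeval z (G.induce (S : Set α)).matchingPoly = 0)
    (hz' : aeval z (G.induce (S.erase v : Set α)).matchingPoly ≠ 0) :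
    z.im = 0 ∧ |z.re| ≤ G.rho := by
  have : Fintype G.Dart := Fintype.ofFinite _
  have hE : E(G).Finite := Set.toFinite _
  obtain ⟨μ, hμ⟩ : ∃ μ : Finset α → ℂ,
      ∀ T : Finset α, aeval z (G.induce (T : Set α)).matchingPoly = μ T := ⟨_, fun _ => rfl⟩
  have hrec : ∀ T : Finset α, ∀ u ∈ T, ∑ d ∈ G.dartsTo u (T.erase u), μ ((T.erase u).erase d.head) =
      z * μ (T.erase u) - μ T := by
    intro T u hu
    have h := congrArg (aeval z) (matchingPoly_eq_sub hE hu)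
    simp only [map_sub, map_mul, aeval_X, map_sum, hμ] at h
    rw [h]
    ring
  rw [hμ] at hz hz'
  let F := (finite_isSelfAvoiding (G := G) hvS).toFinset
  have hF : ∀ w, w ∈ F ↔ IsSelfAvoiding S v w.1 := fun w => by simp [F]
  -- The eigenvector. It is nonzero because its value at the empty walk is `μ (S.erase v)`.
  let Φ : List G.Dart → ℂ := fun w => μ (S \ walkSupport v w)
  have hΦ : ∀ w d, Φ (w ++ [d]) = μ ((S \ walkSupport v w).erase d.head) := fun w d => by
    simp only [Φ, walkSupport_concat, Finset.sdiff_insert]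
  have hsum : ∀ w : List G.Dart,
      ∑ l ∈ (G.dartsTo (walkEnd v w) (S \ walkSupport v w)).image (fun d => w ++ [d]), Φ l =
        ∑ d ∈ G.dartsTo (walkEnd v w) (S \ walkSupport v w),
          μ ((S \ walkSupport v w).erase d.head) := by
    intro w
    rw [Finset.sum_image (fun a _ b _ hab => by simpa using hab)]
    exact Finset.sum_congr rfl fun d _ => hΦ w d
  have hmem : ∀ (w : List G.Dart) (d : G.Dart), IsSelfAvoiding S v w →
      (d ∈ G.dartsTo (walkEnd v w) (S \ walkSupport v w) ↔ IsSelfAvoiding S v (w ++ [d])) :=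
    fun w d hw => by rw [mem_dartsTo, isSelfAvoiding_concat_iff, and_iff_right hw]
  have hfin := finSpectralRadius_induce_universalCover_le_rho hvG F
  suffices h : z.im = 0 ∧ |z.re| ≤ ((G.universalCover v).induce
      (F : Set {w : List G.Dart // G.IsNonBacktracking v w})).finSpectralRadius from
    ⟨h.1, h.2.trans hfin⟩
  refine SimpleGraph.im_eq_zero_and_abs_re_le_finSpectralRadius _ (φ := fun w => Φ w.1.1) ?_ ?_
  · intro h
    refine hz' ?_
    have h0 := congrFun h ⟨⟨[], IsSelfAvoiding.nil.isNonBacktracking (S := S)⟩,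
      (hF _).2 IsSelfAvoiding.nil⟩
    simpa [Φ, walkSupport_nil, Finset.sdiff_singleton_eq_erase] using h0
  rintro ⟨⟨w, hnb⟩, hwF⟩
  have hw : IsSelfAvoiding S v w := (hF _).1 hwF
  rw [← Finset.sum_image (f := Φ) (g := fun u : (F : Set {w : List G.Dart //
    G.IsNonBacktracking v w}) => u.1.1) (fun a _ b _ hab => Subtype.ext (Subtype.ext hab))]
  generalize hN : Finset.image (fun u : (F : Set {w : List G.Dart //
    G.IsNonBacktracking v w}) => u.1.1) _ = N
  have himg : ∀ l, l ∈ N ↔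
      IsSelfAvoiding S v l ∧ ((∃ d, l = w ++ [d]) ∨ ∃ d, w = l ++ [d]) := by
    intro l
    subst hN
    simp only [Finset.mem_image, Finset.mem_filter, Finset.mem_univ, true_and]
    constructor
    · rintro ⟨⟨⟨u, hu⟩, huF⟩, hadj, rfl⟩
      exact ⟨(hF _).1 huF, hadj⟩
    · rintro ⟨hl, hadj⟩
      exact ⟨⟨⟨l, hl.isNonBacktracking⟩, (hF _).2 hl⟩, hadj, rfl⟩
  -- The root has no parent, and the missing term is `μ S = 0`. At `p ++ [e]` the parent `p`
  -- contributes `μ (S \ walkSupport v p)`, exactly the subtracted term of the recurrence for this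
  -- set at `e.head`.
  rcases w.eq_nil_or_concat' with rfl | ⟨p, e, rfl⟩
  · have hset : N = (G.dartsTo (walkEnd v ([] : List G.Dart))
          (S \ walkSupport v ([] : List G.Dart))).image (fun d => [] ++ [d]) := by
      ext l
      rw [himg, Finset.mem_image]
      constructor
      · rintro ⟨hl, ⟨d, rfl⟩ | ⟨d, hd⟩⟩
        · exact ⟨d, (hmem _ _ hw).2 hl, rfl⟩
        · simp at hd
      · rintro ⟨d, hd, rfl⟩
        exact ⟨(hmem _ _ hw).1 hd, Or.inl ⟨d, rfl⟩⟩
    rw [hset, hsum]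
    have := hrec S v hvS
    simpa only [walkEnd_nil, walkSupport_nil, Finset.sdiff_singleton_eq_erase, hz, sub_zero, Φ]
      using this
  · have hset : N = insert p ((G.dartsTo (walkEnd v (p ++ [e]))
          (S \ walkSupport v (p ++ [e]))).image (fun d => (p ++ [e]) ++ [d])) := by
      ext l
      rw [himg, Finset.mem_insert, Finset.mem_image]
      constructor
      · rintro ⟨hl, ⟨d, rfl⟩ | ⟨d, hd⟩⟩
        · exact Or.inr ⟨d, (hmem _ _ hw).2 hl, rfl⟩
        · exact Or.inl (List.append_inj' hd rfl).1.symm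
      · rintro (rfl | ⟨d, hd, rfl⟩)
        · exact ⟨(isSelfAvoiding_concat_iff.1 hw).1, Or.inr ⟨e, rfl⟩⟩
        · exact ⟨(hmem _ _ hw).1 hd, Or.inl ⟨d, rfl⟩⟩
    rw [hset, Finset.sum_insert (by simp), hsum]
    have := hrec (S \ walkSupport v p) e.head (isSelfAvoiding_concat_iff.1 hw).2.2
    rw [walkEnd_concat]
    simp only [Φ, walkSupport_concat, Finset.sdiff_insert]
    rw [this]
    ring

/-- The roots of the matching polynomial of an induced subgraph are real and bounded by the spectral
radius of the universal covering trees. -/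
theorem im_eq_zero_and_abs_re_le_rho [Finite V(G)] [Finite E(G)] {z : ℂ} (S : Finset α)
    (hS : (S : Set α) ⊆ V(G)) (hz : aeval z (G.induce (S : Set α)).matchingPoly = 0) :
    z.im = 0 ∧ |z.re| ≤ G.rho := by
  have : Fintype G.Dart := Fintype.ofFinite _
  induction S using Finset.strongInduction with
  | _ S ih =>
    rcases S.eq_empty_or_nonempty with rfl | ⟨v, hv⟩
    · rw [matchingPoly_induce_empty (Set.toFinite _)] at hz
      simp at hz
    -- Common roots are passed down to `S.erase v`; this ends because the polynomial of the empty
    -- set is `1`.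
    · by_cases h : aeval z (G.induce (S.erase v : Set α)).matchingPoly = 0
      · exact ih _ (Finset.erase_ssubset hv)
          ((Finset.coe_subset.2 (Finset.erase_subset v S)).trans hS) h
      · exact im_eq_zero_and_abs_re_le_rho_of_aeval_erase_ne_zero hv (hS hv) hz h

end PathTree

end Graph

namespace Graph

/-! ### Sums over vertex subsets and Gauss–Lucas -/

section Average

open scoped Classical

variable {α β : Type*} {G : Graph α β}

theorem matchingPoly_induce_coeff_card [Fintype G.Dart] (hE : E(G).Finite) (S : Finset α) :
    (G.induce (S : Set α)).matchingPoly.coeff S.card = 1 := by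
  rw [matchingPoly_induce hE S (S.card + 1) (by omega), finsetSum_coeff,
    Finset.sum_eq_single 0]
  · simp [matchingCount_induce_zero]
  · intro i _ hi
    by_cases h : S.card < 2 * i
    · simp [matchingCount_eq_zero hE _ S i rfl h]
    · rw [coeff_C_mul, coeff_X_pow, if_neg (by omega), mul_zero]
  · simp

/-- The sum of the matching polynomials of the subgraphs induced by the `k`-element subsets. -/
noncomputable def sumMatchingPoly (G : Graph α β) (V : Finset α) (k : ℕ) : ℝ[X] :=
  ∑ S ∈ V.powersetCard k, (G.induce (S : Set α)).matchingPoly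

theorem sumMatchingPoly_coeff [Fintype G.Dart] (hE : E(G).Finite) (V : Finset α) (k : ℕ) :
    (G.sumMatchingPoly V k).coeff k = (V.card.choose k : ℕ) := by
  rw [sumMatchingPoly, finsetSum_coeff, Finset.sum_congr rfl fun S hS => by
    rw [← (Finset.mem_powersetCard.1 hS).2, matchingPoly_induce_coeff_card hE]]
  simp

/-- Double counting: a `k`-subset `T` arises as `S.erase v` once for each `v ∈ V \ T`, with `S =
insert v T`. -/
theorem derivative_sumMatchingPoly [Fintype G.Dart] (hE : E(G).Finite) (V : Finset α) (k : ℕ) :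
    derivative (G.sumMatchingPoly V (k + 1)) =
      ((V.card - k : ℕ) : ℝ[X]) * G.sumMatchingPoly V k := by
  have h1 : ∀ T ∈ V.powersetCard k, ∑ _v ∈ V \ T, (G.induce (T : Set α)).matchingPoly =
      ((V.card - k : ℕ) : ℝ[X]) * (G.induce (T : Set α)).matchingPoly := by
    intro T hT
    rw [Finset.mem_powersetCard] at hT
    rw [Finset.sum_const, Finset.card_sdiff_of_subset hT.1, hT.2, nsmul_eq_mul]
  rw [sumMatchingPoly, derivative_sum, sumMatchingPoly, Finset.mul_sum, ← Finset.sum_congr rfl h1,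
    Finset.sum_congr rfl fun S _ => derivative_matchingPoly hE S, Finset.sum_sigma',
    Finset.sum_sigma']
  refine Finset.sum_bij' (fun p _ => ⟨p.1.erase p.2, p.2⟩) (fun p _ => ⟨insert p.2 p.1, p.2⟩)
    ?_ ?_ ?_ ?_ ?_
  · rintro ⟨S, v⟩ h
    simp only [Finset.mem_sigma, Finset.mem_powersetCard, Finset.mem_sdiff] at h ⊢
    have := Finset.card_erase_add_one h.2
    exact ⟨⟨(Finset.erase_subset _ _).trans h.1.1, by omega⟩, h.1.1 h.2, by simp⟩
  · rintro ⟨T, v⟩ h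
    simp only [Finset.mem_sigma, Finset.mem_powersetCard, Finset.mem_sdiff] at h ⊢
    exact ⟨⟨Finset.insert_subset h.2.1 h.1.1, by rw [Finset.card_insert_of_notMem h.2.2, h.1.2]⟩,
      Finset.mem_insert_self _ _⟩
  · rintro ⟨S, v⟩ h
    simp only [Finset.mem_sigma] at h
    simp [Finset.insert_erase h.2]
  · rintro ⟨T, v⟩ h
    simp only [Finset.mem_sigma, Finset.mem_sdiff] at h
    simp [Finset.erase_insert h.2.2]
  · rintro ⟨S, v⟩ _
    rfl

theorem convex_setOf_im_eq_zero_and_abs_re_le (r : ℝ) :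
    Convex ℝ {z : ℂ | z.im = 0 ∧ |z.re| ≤ r} := by
  have h : {z : ℂ | z.im = 0 ∧ |z.re| ≤ r} =
      Complex.imLm ⁻¹' {0} ∩ Complex.reLm ⁻¹' Set.Icc (-r) r := by
    ext z
    simp [abs_le]
  rw [h]
  exact ((convex_singleton 0).linear_preimage _).inter ((convex_Icc _ _).linear_preimage _)

/-- Gauss–Lucas: the roots of the derivative lie in the convex hull of the roots of `P`, and the
real segment is convex. -/
theorem im_eq_zero_and_abs_re_le_of_derivative {P : ℝ[X]} {r : ℝ} (hP : 0 < P.degree)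
    (h : ∀ z : ℂ, aeval z P = 0 → z.im = 0 ∧ |z.re| ≤ r) {z : ℂ} (hP' : derivative P ≠ 0)
    (hz : aeval z (derivative P) = 0) : z.im = 0 ∧ |z.re| ≤ r := by
  have hmap : Function.Injective (algebraMap ℝ ℂ) := (algebraMap ℝ ℂ).injective
  have hd : 0 < (P.map (algebraMap ℝ ℂ)).degree := by rwa [degree_map]
  have hmem : z ∈ (derivative (P.map (algebraMap ℝ ℂ))).rootSet ℂ := by
    rw [derivative_map, mem_rootSet]
    refine ⟨(Polynomial.map_ne_zero_iff hmap).2 hP', ?_⟩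
    rwa [aeval_map_algebraMap]
  refine convexHull_min ?_ (convex_setOf_im_eq_zero_and_abs_re_le r)
    (rootSet_derivative_subset_convexHull_rootSet hd hmem)
  intro w hw
  rw [mem_rootSet, aeval_map_algebraMap] at hw
  exact h w hw.2

theorem im_eq_zero_and_abs_re_le_rho_of_sumMatchingPoly [Finite V(G)] [Finite E(G)]
    {V : Finset α} (hV : (V : Set α) ⊆ V(G)) {k : ℕ} (hk : k ≤ V.card) {z : ℂ}
    (hz : aeval z (G.sumMatchingPoly V k) = 0) : z.im = 0 ∧ |z.re| ≤ G.rho := by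
  have : Fintype G.Dart := Fintype.ofFinite _
  have hE : E(G).Finite := Set.toFinite _
  induction hk using Nat.decreasingInduction generalizing z with
  | self =>
    rw [sumMatchingPoly, Finset.powersetCard_self, Finset.sum_singleton] at hz
    exact im_eq_zero_and_abs_re_le_rho V hV hz
  | of_succ k hk ih =>
    -- This coefficient gives Gauss–Lucas its hypotheses: positive degree at `k + 1`, and a nonzero
    -- derivative since `k < V.card`.
    have hne : ∀ j ≤ V.card, (G.sumMatchingPoly V j).coeff j ≠ 0 := fun j hj => by
      rw [sumMatchingPoly_coeff hE]
      exact Nat.cast_ne_zero.2 (Nat.choose_pos hj).ne'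
    have hder := derivative_sumMatchingPoly hE V k
    refine im_eq_zero_and_abs_re_le_of_derivative (P := G.sumMatchingPoly V (k + 1)) ?_
      (fun w hw => ih hw) ?_ ?_
    · exact lt_of_lt_of_le (by exact_mod_cast Nat.succ_pos k) (le_degree_of_ne_zero (hne _ hk))
    · rw [hder]
      refine mul_ne_zero (Nat.cast_ne_zero.2 (by omega)) fun h => hne k hk.le ?_
      rw [h, coeff_zero]
    · rw [hder, map_mul, hz, mul_zero]

end Average

end Graph

theorem mainTheorem6 {α β : Type*} (G : Graph α β) (hV : V(G).Finite) (hE : E(G).Finite)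
    (k : ℕ) (hk : 1 ≤ k) (hkn : k ≤ V(G).ncard) :
    (∀ z : ℂ, aeval z (G.avgMatchingPoly hV k) = 0 → z.im = 0) ∧
      ∀ x : ℝ, (G.avgMatchingPoly hV k).IsRoot x → x ∈ Set.Icc (-G.rho) G.rho := by
  have : Finite V(G) := hV
  have : Finite E(G) := hE
  have hroots : ∀ z : ℂ, aeval z (G.avgMatchingPoly hV k) = 0 → z.im = 0 ∧ |z.re| ≤ G.rho := by
    intro z hz
    have hc : (algebraMap ℝ ℂ) (((V(G).ncard.choose k : ℕ) : ℝ)⁻¹) ≠ 0 := by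
      have := (Nat.choose_pos hkn).ne'
      simpa using this
    rw [Graph.avgMatchingPoly, map_mul, aeval_C] at hz
    refine Graph.im_eq_zero_and_abs_re_le_rho_of_sumMatchingPoly (V := hV.toFinset) (by simp) ?_
      ((mul_eq_zero.1 hz).resolve_left hc)
    rwa [← Set.ncard_eq_toFinset_card _ hV]
  refine ⟨fun z hz => (hroots z hz).1, fun x hx => ?_⟩
  have h := (hroots x ?_).2
  · exact abs_le.1 (by simpa using h)
  · rw [← Complex.coe_algebraMap, aeval_algebraMap_apply, coe_aeval_eq_eval, hx.eq_zero, map_zero]
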